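/- Let $K$ be a commutative ring with a derivation $\partial$ (the functions of $x$), and let $C$ be the ring of differential polynomials over $K$ in the dependent variables $q\in\{A_0,A_1,A_2,\dots;\varphi\}$ (that is, polynomials over $K$ in the independent symbols $q^{(k)}$, $k\ge 0$, $q^{(0)}=q$) with $A_0$ inverted; $\partial$ is extended to $C$ by $\partial q^{(k)}=q^{(k+1)}$, and $\varphi_x=\partial\varphi$. Let $\alpha\in K$ be a constant: $\partial\alpha=0$. Let $\mathcal B$ be the matrix of operators on $C$, with rows and columns numbered by the dependent variables, with the entries $$\mathcal B_{nm}=nA_{n+m-1}\partial+\partial\, mA_{n+m-1},\qquad n,m\in\mathbb Z_{\ge 0},$$ $$\mathcal B_{\varphi m}=(\varphi_x+\alpha\varphi\partial)\frac{mA_{m-1}}{A_0},\qquad \mathcal B_{n\varphi}=\frac{nA_{n-1}}{A_0}(\alpha\partial\varphi-\varphi_x),\qquad \mathcal B_{\varphi\varphi}=0,$$ where functions stand for multiplication operators, products are compositions, and a term with $A_{-1}$, whose coefficient is $0$, is $0$. Then $\mathcal B$ is Hamiltonian for every constant $\alpha$. Here, "Hamiltonian" means the following. For $H\in C$ let $\delta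 H$ be the (finite) vector with the components $\frac{\delta H}{\delta q}=\sum_k(-\partial)^k\frac{\partial H}{\partial q^{(k)}}$; for a vector $P$ over $C$ let $D[P](Z)=\sum_{q,k}\frac{\partial P}{\partial q^{(k)}}\,\partial^k Z_q$ be its Fréchet derivative along $Z$; and let $\{H,F\}=(\delta F)^t\,\mathcal B(\delta H)$. Then 1. $\mathcal B$ is skew-adjoint: $Y^t\mathcal B(X)+X^t\mathcal B(Y)\in\partial C$ for all finitely supported vectors $X,Y$ over $C$; 2. the bracket satisfies the Jacobi identity: $\{\{H,F\},G\}+\{\{F,G\},H\}+\{\{G,H\},F\}\in\partial C$ for all $H,F,G\in C$; 3. for all $X=\delta H$ and $Y=\delta F$ with $H,F\in C$ (in particular, for all finitely supported vectors $X,Y$ over $K$), $$\mathcal B\,\delta\!\left[Y^t\mathcal B(X)\right]=D[\mathcal B(Y)]\,\mathcal B(X)-D[\mathcal B(X)]\,\mathcal B(Y).$$ -/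

import Mathlib

open scoped Differential

noncomputable section

namespace BenneyExtension

section Extension

variable {R A L M : Type*} [CommRing R] [CommRing A] [CommRing L] [Algebra R A] [Algebra R L]
  [Algebra A L] [IsScalarTower R A L] (S : Submonoid A) [IsLocalization S L]
  [AddCommGroup M] [Module R M] [Module A M] [Module L M]
  [IsScalarTower R L M] [IsScalarTower A L M] [IsScalarTower R A M]

/-- The extension of a derivation from a ring `A` to a localization `L` of it (the quotient
rule); see `localizedDerivation_algebraMap`, which determines it uniquely. -/
def localizedDerivation (D : Derivation R A M) : Derivation R L M :=
  haveI : Algebra.FormallyEtale A L := Algebra.FormallyEtale.of_isLocalization S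
  ((LinearMap.liftBaseChange L D.liftKaehlerDifferential).comp
    (KaehlerDifferential.tensorKaehlerEquivOfFormallyEtale R A L).symm.toLinearMap).compDer
      (KaehlerDifferential.D R L)

theorem localizedDerivation_algebraMap (D : Derivation R A M) (a : A) :
    localizedDerivation (L := L) S D (algebraMap A L a) = D a := by
  have : Algebra.FormallyEtale A L := Algebra.FormallyEtale.of_isLocalization S
  simp [localizedDerivation,
    KaehlerDifferential.tensorKaehlerEquivOfFormallyEtale_symm_D_algebraMap]

end Extension

/-- The dependent variables: the moments `A₀, A₁, A₂, …` and the additional variable `φ`. -/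
inductive Var where
  | moment (n : ℕ)
  | phi

/-- `(q, k)` stands for the `k`-th `x`-derivative `q^{(k)}` of the dependent variable `q`. -/
abbrev Jet := Var × ℕ

/-- Differential polynomials in the dependent variables with coefficients in the differential
ring `K` (the ring of "functions of `x`"). -/
abbrev DiffPoly (K : Type*) [CommRing K] := MvPolynomial Jet K

/-- The ring of functions: differential polynomials with `A₀` inverted. -/
def FunRing (K : Type*) [CommRing K] :=
  Localization.Away (MvPolynomial.X (Var.moment 0, 0) : DiffPoly K)

instance (K : Type*) [CommRing K] : CommRing (FunRing K) :=
  inferInstanceAs (CommRing (Localization.Away (MvPolynomial.X (Var.moment 0, 0) : DiffPoly K)))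

instance (K : Type*) [CommRing K] : Algebra (DiffPoly K) (FunRing K) :=
  inferInstanceAs (Algebra (DiffPoly K)
    (Localization.Away (MvPolynomial.X (Var.moment 0, 0) : DiffPoly K)))

instance (K : Type*) [CommRing K] : Algebra K (FunRing K) :=
  inferInstanceAs (Algebra K
    (Localization.Away (MvPolynomial.X (Var.moment 0, 0) : DiffPoly K)))

instance (K : Type*) [CommRing K] : IsScalarTower K (DiffPoly K) (FunRing K) :=
  inferInstanceAs (IsScalarTower K (DiffPoly K)
    (Localization.Away (MvPolynomial.X (Var.moment 0, 0) : DiffPoly K)))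

instance (K : Type*) [CommRing K] :
    IsLocalization.Away (MvPolynomial.X (Var.moment 0, 0) : DiffPoly K) (FunRing K) :=
  inferInstanceAs (IsLocalization.Away (MvPolynomial.X (Var.moment 0, 0) : DiffPoly K)
    (Localization.Away (MvPolynomial.X (Var.moment 0, 0) : DiffPoly K)))

section Ring

variable {K : Type*} [CommRing K]

/-- The function `q^{(k)}`. -/
def jet (q : Var) (k : ℕ) : FunRing K := algebraMap (DiffPoly K) (FunRing K) (MvPolynomial.X (q, k))

/-- The moment `Aₙ`. -/
def A (n : ℕ) : FunRing K := jet (Var.moment n) 0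

/-- The variable `φ`. -/
def φ : FunRing K := jet Var.phi 0

/-- The function `1 / A₀`. -/
def invA₀ : FunRing K := IsLocalization.Away.invSelf (MvPolynomial.X (Var.moment 0, 0) : DiffPoly K)

theorem A_zero_mul_invA₀ : (A 0 : FunRing K) * invA₀ = 1 :=
  IsLocalization.Away.mul_invSelf (S := FunRing K) (MvPolynomial.X (Var.moment 0, 0) : DiffPoly K)

/-- The differential of a function: `d f = ∑ (∂f/∂q^{(k)}) dq^{(k)}`, recorded as the finitely
supported family of its coefficients `∂f/∂q^{(k)}`. -/
def d : Derivation K (FunRing K) (Jet →₀ FunRing K) :=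
  localizedDerivation (.powers (MvPolynomial.X (Var.moment 0, 0))) (MvPolynomial.mkDerivation K fun j => Finsupp.single j 1)

theorem d_jet (q : Var) (k : ℕ) : d (jet q k : FunRing K) = Finsupp.single (q, k) 1 := by
  simp [d, jet, localizedDerivation_algebraMap]

end Ring

section Derivative

variable {K : Type*} [CommRing K] [Differential K]

/-- Differentiation of the coefficients of a differential polynomial, as an additive map. -/
def coeffDeriv : DiffPoly K →ₗ[ℤ] DiffPoly K :=
  (AddMonoidAlgebra.coeffLinearEquiv ℤ).symm.toLinearMap ∘ₗ
    Finsupp.mapRange.linearMap (Differential.deriv (R := K)).toLinearMap ∘ₗ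
      (AddMonoidAlgebra.coeffLinearEquiv ℤ).toLinearMap

theorem coeff_coeffDeriv (s : Jet →₀ ℕ) (p : DiffPoly K) :
    (coeffDeriv p).coeff s = (p.coeff s)′ := rfl

/-- Differentiation of the coefficients of a differential polynomial, as a derivation. -/
def coeffDerivation : Derivation ℤ (DiffPoly K) (DiffPoly K) :=
  Derivation.mk' coeffDeriv fun p q => by
    classical
    ext s
    simp only [smul_eq_mul, MvPolynomial.coeff_add, coeff_coeffDeriv]
    rw [mul_comm q, MvPolynomial.coeff_mul, MvPolynomial.coeff_mul, MvPolynomial.coeff_mul,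
      map_sum, ← Finset.sum_add_distrib]
    refine Finset.sum_congr rfl fun x _ => ?_
    simp only [Derivation.leibniz, smul_eq_mul, coeff_coeffDeriv]
    ring

/-- The total `x`-derivative on differential polynomials: it differentiates the coefficients and
sends `q^{(k)}` to `q^{(k+1)}`. -/
def polyDx : Derivation ℤ (DiffPoly K) (DiffPoly K) :=
  coeffDerivation +
    (MvPolynomial.mkDerivation K fun j : Jet =>
      (MvPolynomial.X (j.1, j.2 + 1) : DiffPoly K)).restrictScalars ℤ

/-- The total `x`-derivative `∂` on the ring of functions. -/
def dx : Derivation ℤ (FunRing K) (FunRing K) :=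
  localizedDerivation (.powers (MvPolynomial.X (Var.moment 0, 0))) ((Algebra.linearMap (DiffPoly K) (FunRing K)).compDer polyDx)

theorem dx_jet (q : Var) (k : ℕ) : dx (jet q k : FunRing K) = jet q (k + 1) := by
  have h : coeffDerivation (MvPolynomial.X (q, k) : DiffPoly K) = 0 := by
    classical
    ext s
    change (MvPolynomial.coeff s (MvPolynomial.X (q, k) : DiffPoly K))′ = _
    rw [MvPolynomial.coeff_X]
    split_ifs <;> simp
  simp [dx, jet, localizedDerivation_algebraMap, polyDx, h]

theorem dx_algebraMap (c : K) :
    dx (algebraMap K (FunRing K) c) = algebraMap K (FunRing K) c′ := by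
  have h : coeffDerivation (MvPolynomial.C c : DiffPoly K) = MvPolynomial.C c′ := by
    classical
    ext s
    change (MvPolynomial.coeff s (MvPolynomial.C c : DiffPoly K))′ = _
    rw [MvPolynomial.coeff_C, MvPolynomial.coeff_C]
    split_ifs <;> simp
  rw [IsScalarTower.algebraMap_apply K (DiffPoly K) (FunRing K),
    IsScalarTower.algebraMap_apply K (DiffPoly K) (FunRing K)]
  simp [dx, localizedDerivation_algebraMap, polyDx, MvPolynomial.algebraMap_eq, h]

/-- The vector `δH/δq` of variational derivatives `δH/δq = ∑ₖ (-∂)ᵏ (∂H/∂q^{(k)})`. It is finitely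
supported, since `H` involves finitely many variables. -/
def varDeriv (H : FunRing K) : Var →₀ FunRing K :=
  (d H).curry.mapRange (fun c => c.sum fun k f => (-1) ^ k * dx^[k] f) Finsupp.sum_zero_index

theorem varDeriv_apply (H : FunRing K) (q : Var) :
    varDeriv H q = ((d H).curry q).sum fun k f => (-1) ^ k * dx^[k] f :=
  Finsupp.mapRange_apply

/-- The variational derivative of `∑ X_q q`, with `X_q ∈ K`, is the vector `X`. -/
theorem varDeriv_linear (X : Var →₀ K) (q : Var) :
    varDeriv (X.sum fun r c => algebraMap K (FunRing K) c * jet r 0) q =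
      algebraMap K (FunRing K) (X q) := by
  classical
  have h : d (X.sum fun r c => algebraMap K (FunRing K) c * jet r 0) =
      X.sum fun r c => Finsupp.single (r, 0) (algebraMap K (FunRing K) c) := by
    rw [Finsupp.sum, map_sum]
    refine Finset.sum_congr rfl fun r _ => ?_
    rw [← Algebra.smul_def, Derivation.map_smul, d_jet, Finsupp.smul_single, Algebra.smul_def,
      mul_one]
  have h' : (d (X.sum fun r c => algebraMap K (FunRing K) c * jet r 0)).curry q =
      Finsupp.single 0 (algebraMap K (FunRing K) (X q)) := by
    ext k
    rw [Finsupp.curry_apply, h, Finsupp.sum_apply, Finsupp.sum, Finset.sum_eq_single q]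
    · simp [Finsupp.single_apply]
    · intro r _ hr
      simp [hr]
    · intro hq
      simp [Finsupp.notMem_support_iff.1 hq]
  rw [varDeriv_apply, h', Finsupp.sum_single_index] <;> simp

/-- The Fréchet derivative `D[P](Z) = ∑ (∂P/∂q^{(k)}) ∂ᵏ(Z_q)` of the function `P` along `Z`. -/
def frechet (P : FunRing K) (Z : Var → FunRing K) : FunRing K :=
  (d P).sum fun j f => f * dx^[j.2] (Z j.1)

/-- `Yᵗ Z = ∑ Y_q Z_q`. -/
def pairing (Y : Var →₀ FunRing K) (Z : Var → FunRing K) : FunRing K :=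
  Y.sum fun q y => y * Z q

/-- Matrices whose rows and columns are numbered by the dependent variables, and whose entries are
operators on the ring of functions. -/
abbrev OpMatrix (K : Type*) [CommRing K] := Var → Var → Module.End ℤ (FunRing K)

/-- `B(X)`, with components `B(X)_q = ∑_r B_{qr}(X_r)`. -/
def OpMatrix.app (B : OpMatrix K) (X : Var →₀ FunRing K) (q : Var) : FunRing K :=
  X.sum fun r f => B q r f

/-- The Poisson bracket `{H, F} = (δF/δq)ᵗ B(δH/δq)` of `H` and `F`; it matters modulo the
image of `∂` only. -/
def OpMatrix.bracket (B : OpMatrix K) (H F : FunRing K) : FunRing K :=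
  pairing (varDeriv F) (B.app (varDeriv H))

/-- The matrix `B` is Hamiltonian: it is skew-adjoint, the bracket satisfies the Jacobi
identity modulo the image of `∂`, and the Hamiltonian criterion
`B δ[Yᵗ B(X)] = D[B(Y)] B(X) - D[B(X)] B(Y)` holds for all `X = δH/δq`, `Y = δF/δq`, i.e. the
commutator of the evolution fields with Hamiltonians `H` and `F` has the Hamiltonian `{H, F}`.
Every finite vector `X` over `K` is such an `X`: it is the variational derivative of
`H = ∑ X_q q` (see `varDeriv_linear`). -/
structure OpMatrix.IsHamiltonian (B : OpMatrix K) : Prop where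
  skew_adjoint : ∀ X Y : Var →₀ FunRing K,
    ∃ g, pairing Y (B.app X) + pairing X (B.app Y) = dx g
  jacobi : ∀ H F G : FunRing K,
    ∃ g, B.bracket (B.bracket H F) G + B.bracket (B.bracket F G) H +
      B.bracket (B.bracket G H) F = dx g
  criterion : ∀ H F : FunRing K, ∀ q : Var,
    B.app (varDeriv (pairing (varDeriv F) (B.app (varDeriv H)))) q =
      frechet (B.app (varDeriv F) q) (B.app (varDeriv H)) -
        frechet (B.app (varDeriv H) q) (B.app (varDeriv F))

/-- The operator `∂`. -/
def dxOp : Module.End ℤ (FunRing K) := (dx : Derivation ℤ (FunRing K) (FunRing K)).toLinearMap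

/-- The operator of multiplication by `f`. -/
def mulOp (f : FunRing K) : Module.End ℤ (FunRing K) := LinearMap.mulLeft ℤ f

/-- The extended matrix; products of operators are compositions:
`B_{nm} = n A_{n+m-1} ∂ + ∂ m A_{n+m-1}`, `B_{φm} = (φ_x + α φ ∂) (m A_{m-1} / A₀)`,
`B_{nφ} = (n A_{n-1} / A₀) (α ∂ φ - φ_x)`, `B_{φφ} = 0`.
The index `-1` occurs only with the coefficient `0`. -/
def extMatrix (α : K) : OpMatrix K
  | .moment n, .moment m =>
      mulOp ((n : FunRing K) * A (n + m - 1)) * dxOp + dxOp * mulOp ((m : FunRing K) * A (n + m - 1))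
  | .phi, .moment m =>
      (mulOp (dx φ) + mulOp (algebraMap K (FunRing K) α * φ) * dxOp) *
        mulOp ((m : FunRing K) * A (m - 1) * invA₀)
  | .moment n, .phi =>
      mulOp ((n : FunRing K) * A (n - 1) * invA₀) *
        (mulOp (algebraMap K (FunRing K) α) * dxOp * mulOp φ - mulOp (dx φ))
  | .phi, .phi => 0

end Derivative

end BenneyExtension

end

/-! Write ≡ for equality modulo the image of ∂ and V_X for the evolution field with components B(X).
Paired with a test vector W, the Hamiltonian criterion for X = δH and Y = δF becomes a trilinear
condition on X, Y, W: the first variation formula, the self-adjointness of the Fréchet derivative of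
δH, and skew-adjointness remove every term in which X or Y is differentiated. What is left is the
cyclic sum `schouten`, in which only the coefficients of B are differentiated. If it is ≡ 0, the
criterion follows from the nondegeneracy of the pairing, and the Jacobi identity follows by letting
the commutator of V_X and V_Y act on G (`IsSkew.isHamiltonian`).

For the matrix at hand, `schouten` is additive in each argument and cyclically symmetric, so the
number of φ-components of three one-component vectors leaves four cases. With φ absent, this is the
Hamiltonian property of the moment block. With φ present, set L_h = α∂(φh) - φ_x h; since α is
constant, h ↦ -L_h is the adjoint of φ_x + αφ∂. After integration by parts everything is a multiple
of L_h, and the cofactor vanishes identically. -/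

open scoped Differential

noncomputable section

namespace BenneyExtension

/-! ### Variational calculus: evolution fields, first variation, nondegeneracy of the pairing modulo
∂. -/

section VariationalCalculus

variable {K : Type*} [CommRing K]

/-- A derivation on the ring of functions is determined by its values on the coefficients and on
the variables. -/
theorem derivation_ext {M : Type*} [AddCommGroup M] [Module (FunRing K) M]
    {D₁ D₂ : Derivation ℤ (FunRing K) M}
    (hK : ∀ c : K, D₁ (algebraMap K (FunRing K) c) = D₂ (algebraMap K (FunRing K) c))
    (hj : ∀ q k, D₁ (jet q k) = D₂ (jet q k)) : D₁ = D₂ := by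
  have hp (p : DiffPoly K) : D₁ (algebraMap (DiffPoly K) (FunRing K) p) =
      D₂ (algebraMap (DiffPoly K) (FunRing K) p) := by
    induction p using MvPolynomial.induction_on with
    | C c =>
      have := hK c
      rwa [IsScalarTower.algebraMap_apply K (DiffPoly K) (FunRing K)] at this
    | add p q hp hq => simp only [map_add, hp, hq]
    | mul_X p j hp =>
      have := hj j.1 j.2
      rw [jet] at this
      simp only [map_mul, Derivation.leibniz, hp]
      rw [this]
  ext f
  -- For f = p/s, both derivations satisfy the Leibniz rule on f s = p and agree on p and s, and s
  -- acts invertibly.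
  obtain ⟨⟨p, s⟩, hps⟩ := IsLocalization.surj
    (Submonoid.powers (MvPolynomial.X (Var.moment 0, 0) : DiffPoly K)) f
  have h₁ := congrArg D₁ hps
  have h₂ := congrArg D₂ hps
  simp only [Derivation.leibniz, hp] at h₁ h₂
  have h := h₁.trans h₂.symm
  rw [add_right_inj] at h
  exact (IsLocalization.map_units (FunRing K) s).smul_left_cancel.1 h

theorem pairing_add_left (X Y : Var →₀ FunRing K) (Z : Var → FunRing K) :
    pairing (X + Y) Z = pairing X Z + pairing Y Z :=
  Finsupp.sum_add_index' (by simp) fun _ _ _ => by ring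

theorem pairing_zero_left (Z : Var → FunRing K) : pairing 0 Z = 0 := Finsupp.sum_zero_index

theorem pairing_single (q : Var) (f : FunRing K) (Z : Var → FunRing K) :
    pairing (Finsupp.single q f) Z = f * Z q :=
  Finsupp.sum_single_index (by simp)

theorem pairing_add_right (X : Var →₀ FunRing K) (Z W : Var → FunRing K) :
    pairing X (Z + W) = pairing X Z + pairing X W := by
  simp [pairing, mul_add, Finsupp.sum_add]

theorem pairing_sub_right (X : Var →₀ FunRing K) (Z W : Var → FunRing K) :
    pairing X (Z - W) = pairing X Z - pairing X W := by
  simp [pairing, mul_sub, Finsupp.sum_sub]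

/-- There is a moment that a given function does not involve. -/
theorem exists_moment_notMem (f : FunRing K) : ∃ N, ∀ k, d f (.moment N, k) = 0 := by
  classical
  obtain ⟨N, hN⟩ := Infinite.exists_notMem_finset
    (((d f).support.image Prod.fst).preimage Var.moment (by intro; simp))
  refine ⟨N, fun k => ?_⟩
  by_contra h
  refine hN (Finset.mem_preimage.2 (Finset.mem_image.2 ⟨_, Finsupp.mem_support_iff.2 h, rfl⟩))

variable [Differential K]

/-- The derivation `f ↦ D[f](V)` along the evolution field `V`. -/
def ev (V : Var → FunRing K) : Derivation ℤ (FunRing K) (FunRing K) :=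
  ((Finsupp.linearCombination (FunRing K) fun j : Jet => dx^[j.2] (V j.1)).compDer
    d).restrictScalars ℤ

theorem frechet_eq_ev (P : FunRing K) (V : Var → FunRing K) : frechet P V = ev V P := rfl

theorem ev_jet (V : Var → FunRing K) (q : Var) (k : ℕ) : ev V (jet q k) = dx^[k] (V q) := by
  simp [← frechet_eq_ev, frechet, d_jet]

theorem ev_algebraMap (V : Var → FunRing K) (c : K) : ev V (algebraMap K (FunRing K) c) = 0 := by
  simp [← frechet_eq_ev, frechet]

/-- The commutator of two derivations is a derivation, so generators suffice; `ev V` kills K, which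
∂ preserves. -/
theorem ev_dx (V : Var → FunRing K) (f : FunRing K) : ev V (dx f) = dx (ev V f) := by
  have h : ⁅ev V, (dx : Derivation ℤ (FunRing K) (FunRing K))⁆ = 0 := by
    refine derivation_ext (fun c => ?_) fun q k => ?_
    · simp [Derivation.commutator_apply, dx_algebraMap, ev_algebraMap]
    · simp [Derivation.commutator_apply, dx_jet, ev_jet, Function.iterate_succ_apply']
  rw [← sub_eq_zero, ← Derivation.commutator_apply, h, Derivation.zero_apply]

theorem ev_dx_iterate (V : Var → FunRing K) (k : ℕ) (f : FunRing K) :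
    ev V (dx^[k] f) = dx^[k] (ev V f) := by
  induction k with
  | zero => rfl
  | succ k ih => rw [Function.iterate_succ_apply', ev_dx, ih, Function.iterate_succ_apply']

theorem ev_A (V : Var → FunRing K) (n : ℕ) : ev V (A n) = V (.moment n) := ev_jet V _ 0

theorem ev_φ (V : Var → FunRing K) : ev V φ = V .phi := ev_jet V _ 0

theorem dx_iterate_sub (k : ℕ) (f g : FunRing K) : dx^[k] (f - g) = dx^[k] f - dx^[k] g :=
  iterate_map_sub dx k f g

/-- Evolution fields are closed under the commutator. -/
theorem ev_commutator (Z W : Var → FunRing K) (f : FunRing K) :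
    ev Z (ev W f) - ev W (ev Z f) = ev (fun q => ev Z (W q) - ev W (Z q)) f := by
  have h : ⁅ev Z, ev W⁆ = ev fun q => ev Z (W q) - ev W (Z q) := by
    refine derivation_ext (fun c => ?_) fun q k => ?_
    · simp [Derivation.commutator_apply, ev_algebraMap]
    · simp only [Derivation.commutator_apply, ev_jet, ev_dx_iterate, dx_iterate_sub]
  rw [← Derivation.commutator_apply, h]

theorem ev_add (V W : Var → FunRing K) (f : FunRing K) : ev (V + W) f = ev V f + ev W f := by
  have h : ev (V + W) = ev V + ev W := by
    refine derivation_ext (fun c => ?_) fun q k => ?_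
    · simp [ev_algebraMap]
    · simp [ev_jet]
  rw [h, Derivation.add_apply]

/-- The image of `∂`. -/
def exact (K : Type*) [CommRing K] [Differential K] : AddSubgroup (FunRing K) :=
  (dx : Derivation ℤ (FunRing K) (FunRing K)).toLinearMap.toAddMonoidHom.range

theorem mem_exact {f : FunRing K} : f ∈ exact K ↔ ∃ g, f = dx g := by
  simp only [exact, AddMonoidHom.mem_range, eq_comm (a := f)]
  rfl

theorem dx_mem_exact (f : FunRing K) : dx f ∈ exact K := mem_exact.2 ⟨f, rfl⟩

theorem ev_mem_exact (V : Var → FunRing K) {f : FunRing K} (hf : f ∈ exact K) :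
    ev V f ∈ exact K := by
  obtain ⟨g, rfl⟩ := mem_exact.1 hf
  rw [ev_dx]
  exact dx_mem_exact _

/-- Integration by parts. -/
theorem mul_dx_iterate_sub_mem_exact (k : ℕ) (f z : FunRing K) :
    f * dx^[k] z - (-1) ^ k * dx^[k] f * z ∈ exact K := by
  induction k generalizing f with
  | zero => simp
  | succ k ih =>
    have h := add_mem (dx_mem_exact (f * dx^[k] z)) (neg_mem (ih (dx f)))
    convert h using 1
    rw [Derivation.leibniz, Function.iterate_succ_apply', Function.iterate_succ_apply]
    simp only [smul_eq_mul]
    ring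

/-- The adjoint of `Z ↦ ∑ m_{q,k} ∂ᵏ Z_q`, applied to `1`. -/
def euler : (Jet →₀ FunRing K) →+ (Var →₀ FunRing K) :=
  (Finsupp.mapRange.addMonoidHom (Finsupp.liftAddHom fun k : ℕ =>
    (AddMonoidHom.mulLeft ((-1 : FunRing K) ^ k)).comp
      ((dx : Derivation ℤ (FunRing K) (FunRing K)).toLinearMap ^ k).toAddMonoidHom)).comp
    (Finsupp.curryAddEquiv (α := Var) (β := ℕ) (M := FunRing K)).toAddMonoidHom

theorem varDeriv_eq_euler (H : FunRing K) : varDeriv H = euler (d H) := by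
  ext q
  simp [varDeriv_apply, euler, Finsupp.sum, Module.End.pow_apply]

theorem euler_single (q : Var) (k : ℕ) (f : FunRing K) :
    euler (Finsupp.single (q, k) f) = Finsupp.single q ((-1) ^ k * dx^[k] f) := by
  simp [euler, Finsupp.curry_single, Module.End.pow_apply]

/-- The first variation formula: `D[H](V) = (δH)ᵗ V` modulo the image of `∂`. -/
theorem ev_sub_pairing_varDeriv_mem_exact (V : Var → FunRing K) (H : FunRing K) :
    ev V H - pairing (varDeriv H) V ∈ exact K := by
  rw [varDeriv_eq_euler, ← frechet_eq_ev, frechet]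
  induction d H using Finsupp.induction_linear with
  | zero => simp [pairing_zero_left]
  | add m n hm hn =>
    rw [map_add, pairing_add_left, Finsupp.sum_add_index' (by simp) fun _ _ _ => by ring]
    convert add_mem hm hn using 1
    ring
  | single j f =>
    rw [Finsupp.sum_single_index (by simp), euler_single, pairing_single]
    exact mul_dx_iterate_sub_mem_exact _ _ _

/-- `∂`, acting on differentials: `f dq^{(k)} ↦ f' dq^{(k)} + f dq^{(k+1)}`. -/
def dxDifferential : (Jet →₀ FunRing K) →ₗ[ℤ] (Jet →₀ FunRing K) :=
  Finsupp.mapRange.linearMap dx.toLinearMap + Finsupp.lmapDomain (FunRing K) ℤ fun j => (j.1, j.2 + 1)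

theorem dxDifferential_single (q : Var) (k : ℕ) (f : FunRing K) :
    dxDifferential (Finsupp.single (q, k) f) =
      Finsupp.single (q, k) (dx f) + Finsupp.single (q, k + 1) f := by
  simp [dxDifferential, Finsupp.mapDomain_single]

theorem dxDifferential_smul (f : FunRing K) (m : Jet →₀ FunRing K) :
    dxDifferential (f • m) = f • dxDifferential m + dx f • m := by
  induction m using Finsupp.induction_linear with
  | zero => simp
  | add m n hm hn =>
    rw [smul_add, map_add, map_add, hm, hn, smul_add, smul_add]
    abel
  | single j g =>
    rw [Finsupp.smul_single, dxDifferential_single, dxDifferential_single, smul_eq_mul,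
      Derivation.leibniz, smul_add, Finsupp.smul_single, Finsupp.smul_single, Finsupp.smul_single,
      Finsupp.single_add]
    simp only [smul_eq_mul, mul_comm g]
    abel

/-- By `dxDifferential_smul`, the difference of the two sides is a derivation in f, so it need only
vanish on coefficients and jets. -/
theorem d_dx (f : FunRing K) : d (dx f) = dxDifferential (d f) := by
  let D : Derivation ℤ (FunRing K) (Jet →₀ FunRing K) :=
    Derivation.mk' ((d.restrictScalars ℤ).toLinearMap ∘ₗ dx.toLinearMap -
      dxDifferential ∘ₗ (d.restrictScalars ℤ).toLinearMap) fun f g => by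
        simp only [LinearMap.sub_apply, LinearMap.comp_apply, Derivation.coe_restrictScalars,
          Derivation.coeFn_coe, Derivation.coe_restrictScalars, Derivation.leibniz, map_add,
          dxDifferential_smul, smul_eq_mul, smul_sub]
        abel
  have h : D = 0 := by
    refine derivation_ext (fun c => ?_) fun q k => ?_
    · simp [D, dx_algebraMap]
    · simp [D, dx_jet, d_jet, dxDifferential_single]
  exact sub_eq_zero.1 (congrArg (fun D => D f) h)

/-- A term g dq^{(k)} of df contributes (-∂)ᵏ∂g from g' dq^{(k)} and (-∂)ᵏ⁺¹g from g dq^{(k+1)},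
which cancel. -/
theorem varDeriv_dx (f : FunRing K) : varDeriv (dx f) = 0 := by
  rw [varDeriv_eq_euler, d_dx]
  induction d f using Finsupp.induction_linear with
  | zero => simp
  | add m n hm hn => rw [map_add, map_add, hm, hn, add_zero]
  | single j g =>
    rw [dxDifferential_single, map_add, euler_single, euler_single, ← Finsupp.single_add,
      Function.iterate_succ_apply, pow_succ]
    simp

/-- The pairing modulo the image of `∂` is nondegenerate. -/
theorem eq_zero_of_forall_mul_mem_exact {f : FunRing K} (h : ∀ z, z * f ∈ exact K) : f = 0 := by
  -- Test against a moment A_N absent from f, available since there are infinitely many moments: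
  -- then δ(A_N f)/δA_N = f, while δ annihilates the image of ∂.
  obtain ⟨N, hN⟩ := exists_moment_notMem f
  obtain ⟨g, hg⟩ := mem_exact.1 (h (A N))
  have h₁ : varDeriv (A N * f) (.moment N) = 0 := by rw [hg, varDeriv_dx]; rfl
  have h₂ : (d (A N * f)).curry (.moment N) = Finsupp.single 0 f := by
    ext k
    rw [Finsupp.curry_apply, Derivation.leibniz, A, d_jet]
    by_cases hk : k = 0 <;> simp [hN, hk]
  rwa [varDeriv_apply, h₂, Finsupp.sum_single_index (by simp), pow_zero, one_mul] at h₁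

end VariationalCalculus

/-! ### Skew-adjointness and a vanishing Schouten bracket imply the Hamiltonian property. -/

section Hamiltonian

variable {K : Type*} [CommRing K]

theorem OpMatrix.app_add (B : OpMatrix K) (X Y : Var →₀ FunRing K) :
    B.app (X + Y) = B.app X + B.app Y := by
  funext q
  exact Finsupp.sum_add_index' (by simp) fun _ _ _ => map_add _ _ _

theorem OpMatrix.app_zero (B : OpMatrix K) : B.app 0 = 0 := by
  funext q
  exact Finsupp.sum_zero_index

theorem OpMatrix.app_single (B : OpMatrix K) (r : Var) (f : FunRing K) :
    B.app (Finsupp.single r f) = fun q => B q r f := by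
  funext q
  exact Finsupp.sum_single_index (by simp)

variable [Differential K]

/-- The derivative of a finitely supported vector along the evolution field `V`. -/
def evVec (V : Var → FunRing K) (X : Var →₀ FunRing K) : Var →₀ FunRing K :=
  X.mapRange (ev V) (map_zero _)

theorem evVec_apply (V : Var → FunRing K) (X : Var →₀ FunRing K) (q : Var) :
    evVec V X q = ev V (X q) :=
  Finsupp.mapRange_apply

theorem evVec_add (V : Var → FunRing K) (X Y : Var →₀ FunRing K) :
    evVec V (X + Y) = evVec V X + evVec V Y := by
  ext q
  simp [evVec_apply]

theorem evVec_zero (V : Var → FunRing K) : evVec V 0 = 0 := by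
  ext q
  simp [evVec_apply]

theorem evVec_single (V : Var → FunRing K) (q : Var) (f : FunRing K) :
    evVec V (Finsupp.single q f) = Finsupp.single q (ev V f) := by
  simp [evVec]

theorem evVec_add_field (V W : Var → FunRing K) (X : Var →₀ FunRing K) :
    evVec (V + W) X = evVec V X + evVec W X := by
  ext q
  simp [evVec_apply, ev_add]

theorem ev_pairing (V : Var → FunRing K) (Y : Var →₀ FunRing K) (Z : Var → FunRing K) :
    ev V (pairing Y Z) = pairing (evVec V Y) Z + pairing Y fun q => ev V (Z q) := by
  induction Y using Finsupp.induction_linear with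
  | zero => simp [evVec_zero, pairing_zero_left]
  | add X Y hX hY =>
    rw [evVec_add, pairing_add_left, pairing_add_left, pairing_add_left, map_add, hX, hY]
    ring
  | single q f =>
    simp only [evVec_single, pairing_single, Derivation.leibniz, smul_eq_mul]
    ring

/-- The Fréchet derivative of a variational derivative is self-adjoint. -/
theorem pairing_evVec_varDeriv_sub_mem_exact (H : FunRing K) (Z W : Var → FunRing K) :
    pairing (evVec Z (varDeriv H)) W - pairing (evVec W (varDeriv H)) Z ∈ exact K := by
  -- Differentiate the first variation formula for W along Z, and conversely; in the difference, the
  -- second derivatives of H are absorbed by the formula for the commutator field.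
  have h₁ := ev_mem_exact Z (ev_sub_pairing_varDeriv_mem_exact W H)
  have h₂ := ev_mem_exact W (ev_sub_pairing_varDeriv_mem_exact Z H)
  have h₃ := ev_sub_pairing_varDeriv_mem_exact (fun q => ev Z (W q) - ev W (Z q)) H
  have h₄ := pairing_sub_right (varDeriv H) (fun q => ev Z (W q)) fun q => ev W (Z q)
  rw [← ev_commutator] at h₃
  rw [map_sub, ev_pairing] at h₁ h₂
  convert sub_mem (sub_mem h₃ h₁) (neg_mem h₂) using 1
  change pairing (varDeriv H) (fun q => ev Z (W q) - ev W (Z q)) = _ at h₄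
  rw [h₄]
  ring

namespace OpMatrix

variable (B : OpMatrix K)

/-- The derivative of the coefficients of the operator matrix `B` along the evolution field `V`,
applied to `X`. -/
def variation (V : Var → FunRing K) (X : Var →₀ FunRing K) (q : Var) : FunRing K :=
  ev V (B.app X q) - B.app (evVec V X) q

theorem variation_add (V : Var → FunRing K) (X Y : Var →₀ FunRing K) :
    B.variation V (X + Y) = B.variation V X + B.variation V Y := by
  funext q
  simp only [variation, evVec_add, app_add, Pi.add_apply, map_add]
  ring

theorem variation_add_field (V W : Var → FunRing K) (X : Var →₀ FunRing K) :
    B.variation (V + W) X = B.variation V X + B.variation W X := by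
  funext q
  simp only [variation, evVec_add_field, app_add, Pi.add_apply, ev_add]
  ring

theorem variation_single (V : Var → FunRing K) (r : Var) (f : FunRing K) (q : Var) :
    B.variation V (Finsupp.single r f) q = ev V (B q r f) - B q r (ev V f) := by
  simp [variation, evVec_single, app_single]

theorem pairing_ev_app (V : Var → FunRing K) (X Y : Var →₀ FunRing K) :
    (pairing Y fun q => ev V (B.app X q)) =
      pairing Y (B.variation V X) + pairing Y (B.app (evVec V X)) := by
  rw [← pairing_add_right]
  congr 1
  funext q
  simp [variation]

/-- The matrix `B` is skew-adjoint. -/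
def IsSkew : Prop :=
  ∀ X Y : Var →₀ FunRing K, pairing Y (B.app X) + pairing X (B.app Y) ∈ exact K

/-- The value on `X, Y, W` of the Schouten bracket of `B` with itself. -/
def schouten (X Y W : Var →₀ FunRing K) : FunRing K :=
  pairing Y (B.variation (B.app W) X) + pairing W (B.variation (B.app X) Y) +
    pairing X (B.variation (B.app Y) W)

/-- With this symmetry, additivity is needed in the first argument only, and the cases below need
only be treated up to rotation. -/
theorem schouten_rotate (X Y W : Var →₀ FunRing K) : B.schouten Y W X = B.schouten X Y W := by
  simp only [schouten]
  ring

variable {B}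

theorem isSkew_of_single
    (h : ∀ (q r : Var) (f g : FunRing K), g * B r q f + f * B q r g ∈ exact K) :
    B.IsSkew := by
  intro X Y
  induction X using Finsupp.induction_linear with
  | zero => simp [app_zero, pairing]
  | add X X' hX hX' =>
    convert add_mem hX hX' using 1
    rw [app_add, pairing_add_left, pairing_add_right]
    ring
  | single q f =>
    induction Y using Finsupp.induction_linear with
    | zero => simp [app_zero, pairing]
    | add Y Y' hY hY' =>
      convert add_mem hY hY' using 1
      rw [app_add, pairing_add_left, pairing_add_right]
      ring
    | single r g => simpa only [app_single, pairing_single] using h q r f g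

theorem schouten_add (X X' Y W : Var →₀ FunRing K) :
    B.schouten (X + X') Y W = B.schouten X Y W + B.schouten X' Y W := by
  simp only [schouten, variation_add, variation_add_field, app_add, pairing_add_left,
    pairing_add_right]
  ring

theorem schouten_zero (Y W : Var →₀ FunRing K) : B.schouten 0 Y W = 0 := by
  simpa using schouten_add (B := B) 0 0 Y W

theorem schouten_mem_exact_of_single
    (h : ∀ (q r s : Var) (f g k : FunRing K),
      B.schouten (.single q f) (.single r g) (.single s k) ∈ exact K)
    (X Y W : Var →₀ FunRing K) : B.schouten X Y W ∈ exact K := by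
  induction X using Finsupp.induction_linear with
  | zero => simp [schouten_zero]
  | add X X' hX hX' => simpa only [schouten_add] using add_mem hX hX'
  | single q f =>
    rw [← schouten_rotate]
    induction Y using Finsupp.induction_linear with
    | zero => simp [schouten_zero]
    | add X X' hX hX' => simpa only [schouten_add] using add_mem hX hX'
    | single r g =>
      rw [← schouten_rotate]
      induction W using Finsupp.induction_linear with
      | zero => simp [schouten_zero]
      | add X X' hX hX' => simpa only [schouten_add] using add_mem hX hX'
      | single s k =>
        rw [← schouten_rotate]
        exact h q r s f g k

/-- Differentiate the skew-adjointness relation along V; the terms in which X or Y is differentiated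
are themselves instances of it. -/
theorem IsSkew.variation (hB : B.IsSkew) (V : Var → FunRing K) (X Y : Var →₀ FunRing K) :
    pairing Y (B.variation V X) + pairing X (B.variation V Y) ∈ exact K := by
  have h := ev_mem_exact V (hB X Y)
  rw [map_add, ev_pairing, ev_pairing, pairing_ev_app, pairing_ev_app] at h
  convert sub_mem h (add_mem (hB X (evVec V Y)) (hB (evVec V X) Y)) using 1
  ring

/-- For a skew-adjoint matrix whose Schouten bracket with itself vanishes, the commutator of the
evolution fields with Hamiltonians `H` and `F` has the Hamiltonian `{H, F}`. -/
theorem IsSkew.app_varDeriv_bracket (hB : B.IsSkew)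
    (hS : ∀ X Y W : Var →₀ FunRing K, B.schouten X Y W ∈ exact K) (H F : FunRing K) (q : Var) :
    B.app (varDeriv (B.bracket H F)) q =
      ev (B.app (varDeriv H)) (B.app (varDeriv F) q) -
        ev (B.app (varDeriv F)) (B.app (varDeriv H) q) := by
  rw [← sub_eq_zero]
  refine eq_zero_of_forall_mul_mem_exact fun z => ?_
  set X := varDeriv H with hX
  set Y := varDeriv F with hY
  set W : Var →₀ FunRing K := .single q z with hW
  set V := B.app W
  -- Modulo ∂, ⟨W, Bδ{H,F}⟩ ≡ -⟨δ{H,F}, V⟩ ≡ -D[{H,F}](V). Expand by the product rule; `h₄`–`h₈`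
  -- move the derivatives of X and Y along V to derivatives along B(Y) and B(X), matching the terms
  -- on the right side of the criterion. The terms with differentiated coefficients form minus the
  -- Schouten sum once `h₀` exchanges X and W.
  have h₁ := hB (varDeriv (B.bracket H F)) W
  have h₂ := ev_sub_pairing_varDeriv_mem_exact V (B.bracket H F)
  rw [bracket, ev_pairing, pairing_ev_app, ← bracket] at h₂
  have h₄ := pairing_evVec_varDeriv_sub_mem_exact F V (B.app X)
  have h₅ := hB (evVec V X) Y
  have h₆ := pairing_evVec_varDeriv_sub_mem_exact H V (B.app Y)
  have h₇ := hB (evVec (B.app X) Y) W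
  have h₈ := hB (evVec (B.app Y) X) W
  have h₉ := hS X Y W
  have h₀ := hB.variation (B.app Y) X W
  have e₁ := B.pairing_ev_app (B.app X) Y W
  have e₂ := B.pairing_ev_app (B.app Y) X W
  have e₃ : z * (B.app (varDeriv (B.bracket H F)) q -
      (ev (B.app X) (B.app Y q) - ev (B.app Y) (B.app X q))) =
      pairing W (B.app (varDeriv (B.bracket H F))) - (pairing W (fun q => ev (B.app X) (B.app Y q)) -
        pairing W fun q => ev (B.app Y) (B.app X q)) := by
    simp only [hW, pairing_single]
    ring
  rw [e₃, e₁, e₂]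
  rw [schouten] at h₉
  convert add_mem (sub_mem (add_mem (sub_mem (add_mem (sub_mem (sub_mem (add_mem h₁ h₂) h₄) h₅) h₆)
    h₇) h₈) h₉) h₀ using 1
  ring

/-- A skew-adjoint matrix whose Schouten bracket with itself vanishes is Hamiltonian. -/
theorem IsSkew.isHamiltonian (hB : B.IsSkew)
    (hS : ∀ X Y W : Var →₀ FunRing K, B.schouten X Y W ∈ exact K) : B.IsHamiltonian where
  skew_adjoint X Y := mem_exact.1 (hB X Y)
  criterion := hB.app_varDeriv_bracket hS
  jacobi H F G := by
    -- The first double bracket is ≡ the commutator of the two fields applied to G. The other two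
    -- are, by skew-adjointness and first variation, ≡ -D[{F,G}] along B(δH) and -D[{G,H}] along
    -- B(δF), which cancel it.
    have h₁ : B.bracket (B.bracket H F) G = pairing (varDeriv G) fun q =>
        ev (B.app (varDeriv H)) (B.app (varDeriv F) q) -
          ev (B.app (varDeriv F)) (B.app (varDeriv H) q) := by
      rw [bracket]
      exact congrArg _ (funext (hB.app_varDeriv_bracket hS H F))
    have h₂ := ev_sub_pairing_varDeriv_mem_exact (fun q =>
        ev (B.app (varDeriv H)) (B.app (varDeriv F) q) -
          ev (B.app (varDeriv F)) (B.app (varDeriv H) q)) G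
    rw [← h₁, ← ev_commutator] at h₂
    have h₃ := ev_mem_exact (B.app (varDeriv H))
      (ev_sub_pairing_varDeriv_mem_exact (B.app (varDeriv F)) G)
    have h₄ := ev_mem_exact (B.app (varDeriv F))
      (ev_sub_pairing_varDeriv_mem_exact (B.app (varDeriv H)) G)
    have h₅ := ev_mem_exact (B.app (varDeriv F)) (hB (varDeriv H) (varDeriv G))
    have h₆ := hB (varDeriv (B.bracket F G)) (varDeriv H)
    have h₇ := ev_sub_pairing_varDeriv_mem_exact (B.app (varDeriv H)) (B.bracket F G)
    have h₈ := hB (varDeriv (B.bracket G H)) (varDeriv F)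
    have h₉ := ev_sub_pairing_varDeriv_mem_exact (B.app (varDeriv F)) (B.bracket G H)
    rw [map_sub] at h₃ h₄
    rw [map_add] at h₅
    refine mem_exact.1 ?_
    convert add_mem (add_mem (add_mem (add_mem (sub_mem (sub_mem (sub_mem h₃ h₂) h₄) h₅) h₆) h₇) h₈)
      h₉ using 1
    simp only [bracket]
    ring

end OpMatrix

end Hamiltonian

/-! ### The extended Benney matrix: entries, skew-adjointness, coefficient variations. -/

section Benney

variable {K : Type*} [CommRing K] [Differential K]

theorem dx_invA₀ : dx (invA₀ : FunRing K) = -invA₀ ^ 2 * dx (A 0) :=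
  Derivation.leibniz_of_mul_eq_one _ (by rw [mul_comm, A_zero_mul_invA₀])

theorem ev_invA₀ (V : Var → FunRing K) : ev V invA₀ = -invA₀ ^ 2 * V (.moment 0) := by
  rw [← ev_A V 0]
  exact Derivation.leibniz_of_mul_eq_one _ (by rw [mul_comm, A_zero_mul_invA₀])

section Entries

variable (α : K)

theorem extMatrix_moment_moment (n m : ℕ) (f : FunRing K) :
    extMatrix α (.moment n) (.moment m) f =
      (n : FunRing K) * A (n + m - 1) * dx f + dx ((m : FunRing K) * A (n + m - 1) * f) := rfl

theorem extMatrix_phi_moment (m : ℕ) (f : FunRing K) :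
    extMatrix α .phi (.moment m) f = dx φ * ((m : FunRing K) * A (m - 1) * invA₀ * f) +
      algebraMap K (FunRing K) α * φ * dx ((m : FunRing K) * A (m - 1) * invA₀ * f) := rfl

theorem extMatrix_moment_phi (n : ℕ) (f : FunRing K) :
    extMatrix α (.moment n) .phi f = (n : FunRing K) * A (n - 1) * invA₀ *
      (algebraMap K (FunRing K) α * dx (φ * f) - dx φ * f) := rfl

theorem extMatrix_phi_phi (f : FunRing K) : extMatrix α .phi .phi f = 0 := rfl

/-- The value of `B_{p-1,k}`, multiplied by a coefficient that vanishes for `p = 0`. -/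
theorem mul_extMatrix_pred_moment {c : FunRing K} {p : ℕ} (hc : p = 0 → c = 0) (k : ℕ)
    (f : FunRing K) :
    c * extMatrix α (.moment (p - 1)) (.moment k) f =
      c * (((p : FunRing K) - 1) * A (p + k - 2) * dx f +
        dx ((k : FunRing K) * A (p + k - 2) * f)) := by
  -- At p = 0 the truncated index p - 1 is 0 and the formula for the entry fails, but c vanishes
  -- there.
  obtain _ | p := p
  · simp [hc]
  · rw [extMatrix_moment_moment, show p + 1 - 1 + k - 1 = p + 1 + k - 2 by omega]
    push_cast
    simp

/-- The value of `B_{p-1,φ}`, multiplied by a coefficient that vanishes for `p = 0`. -/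
theorem mul_extMatrix_pred_phi {c : FunRing K} {p : ℕ} (hc : p = 0 → c = 0) (f : FunRing K) :
    c * extMatrix α (.moment (p - 1)) .phi f =
      c * (((p : FunRing K) - 1) * A (p - 2) * invA₀ *
        (algebraMap K (FunRing K) α * dx (φ * f) - dx φ * f)) := by
  obtain _ | p := p
  · simp [hc]
  · rw [extMatrix_moment_phi, show p + 1 - 1 - 1 = p + 1 - 2 by omega]
    push_cast
    simp

/-- The row of A₀ is needed separately because the variation of 1/A₀ along V is -V_{A₀}/A₀². -/
theorem extMatrix_moment_zero_moment (n : ℕ) (f : FunRing K) :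
    extMatrix α (.moment 0) (.moment n) f = dx ((n : FunRing K) * A (n - 1) * f) := by
  simp [extMatrix_moment_moment]

theorem extMatrix_moment_zero_phi (f : FunRing K) : extMatrix α (.moment 0) .phi f = 0 := by
  simp [extMatrix_moment_phi]

theorem extMatrix_isSkew (hα : Differential.deriv α = 0) : (extMatrix α).IsSkew := by
  have hα' : dx (algebraMap K (FunRing K) α) = 0 := by rw [dx_algebraMap, hα, map_zero]
  have hmφ (n : ℕ) (f g : FunRing K) : g * extMatrix α (.moment n) .phi f +
      f * extMatrix α .phi (.moment n) g ∈ exact K := by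
    -- The boundary term of αφ∂, the only derivative to be moved; it is exact because α is constant.
    refine mem_exact.2 ⟨(n : FunRing K) * A (n - 1) * invA₀ * g *
      (algebraMap K (FunRing K) α * φ * f), ?_⟩
    simp only [extMatrix_phi_moment, extMatrix_moment_phi, Derivation.leibniz, smul_eq_mul, hα']
    ring
  refine OpMatrix.isSkew_of_single fun q r f g => ?_
  obtain n | _ := q <;> obtain m | _ := r
  · refine mem_exact.2 ⟨((n : FunRing K) + (m : FunRing K)) * A (n + m - 1) * f * g, ?_⟩
    simp only [extMatrix_moment_moment, add_comm m n, Derivation.leibniz, smul_eq_mul, map_add,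
      Derivation.map_natCast]
    ring
  · rw [add_comm]
    exact hmφ n g f
  · exact hmφ m f g
  · simp [extMatrix_phi_phi]

variable (V : Var → FunRing K)

theorem variation_moment_moment (n m : ℕ) (f : FunRing K) :
    (extMatrix α).variation V (.single (.moment m) f) (.moment n) =
      (n : FunRing K) * V (.moment (n + m - 1)) * dx f +
        dx ((m : FunRing K) * V (.moment (n + m - 1)) * f) := by
  simp only [OpMatrix.variation_single, extMatrix_moment_moment, map_add, Derivation.leibniz,
    smul_eq_mul, ev_dx, ev_A, Derivation.map_natCast, map_zero]
  ring

theorem variation_phi_moment (m : ℕ) (f : FunRing K) :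
    (extMatrix α).variation V (.single (.moment m) f) .phi =
      dx (V .phi) * ((m : FunRing K) * A (m - 1) * invA₀ * f) +
        algebraMap K (FunRing K) α * V .phi * dx ((m : FunRing K) * A (m - 1) * invA₀ * f) +
      dx φ * (((m : FunRing K) * V (.moment (m - 1)) * invA₀ -
        (m : FunRing K) * A (m - 1) * invA₀ ^ 2 * V (.moment 0)) * f) +
        algebraMap K (FunRing K) α * φ *
          dx (((m : FunRing K) * V (.moment (m - 1)) * invA₀ -
            (m : FunRing K) * A (m - 1) * invA₀ ^ 2 * V (.moment 0)) * f) := by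
  have h : ev V ((m : FunRing K) * A (m - 1) * invA₀ * f) =
      (m : FunRing K) * A (m - 1) * invA₀ * ev V f +
      ((m : FunRing K) * V (.moment (m - 1)) * invA₀ -
        (m : FunRing K) * A (m - 1) * invA₀ ^ 2 * V (.moment 0)) * f := by
    simp only [Derivation.leibniz, smul_eq_mul, ev_A, ev_invA₀, Derivation.map_natCast]
    ring
  rw [OpMatrix.variation_single, extMatrix_phi_moment, extMatrix_phi_moment]
  -- Keeping the argument of ∂ as a single symbol leaves its derivative unexpanded, as in the
  -- target.
  generalize (m : FunRing K) * A (m - 1) * invA₀ * f = b at h ⊢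
  simp only [map_add, Derivation.leibniz, smul_eq_mul, ev_dx, h, ev_algebraMap, ev_φ]
  ring

theorem variation_moment_phi (n : ℕ) (f : FunRing K) :
    (extMatrix α).variation V (.single .phi f) (.moment n) =
      ((n : FunRing K) * V (.moment (n - 1)) * invA₀ -
        (n : FunRing K) * A (n - 1) * invA₀ ^ 2 * V (.moment 0)) *
        (algebraMap K (FunRing K) α * dx (φ * f) - dx φ * f) +
      (n : FunRing K) * A (n - 1) * invA₀ *
        (algebraMap K (FunRing K) α * dx (V .phi * f) - dx (V .phi) * f) := by
  simp only [OpMatrix.variation_single, extMatrix_moment_phi, map_add, map_sub, Derivation.leibniz,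
    smul_eq_mul, ev_dx, ev_A, ev_φ, ev_invA₀, ev_algebraMap, Derivation.map_natCast]
  ring

theorem variation_phi_phi (f : FunRing K) :
    (extMatrix α).variation V (.single .phi f) .phi = 0 := by
  simp [OpMatrix.variation_single, extMatrix_phi_phi]

end Entries

/-! ### The Schouten bracket of the extended matrix, by the number of φ-components. -/

section Schouten

variable (α : K)

theorem schouten_moment_moment_moment (n m k : ℕ) (f g h : FunRing K) :
    (extMatrix α).schouten (.single (.moment n) f) (.single (.moment m) g)
      (.single (.moment k) h) ∈ exact K := by
  -- Index shifts add up: all three cyclic terms involve the same moment A_{n+m+k-2}.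
  have key (n m k : ℕ) (f h : FunRing K) :
      (extMatrix α).variation ((extMatrix α).app (.single (.moment k) h)) (.single (.moment n) f)
        (.moment m) =
      (m : FunRing K) * ((((m + n : ℕ) : FunRing K) - 1) * A (n + m + k - 2) * dx h +
        dx ((k : FunRing K) * A (n + m + k - 2) * h)) * dx f +
        dx ((n : FunRing K) * ((((m + n : ℕ) : FunRing K) - 1) * A (n + m + k - 2) * dx h +
        dx ((k : FunRing K) * A (n + m + k - 2) * h)) * f) := by
    rw [variation_moment_moment, OpMatrix.app_single,
      mul_extMatrix_pred_moment α (fun h => by simp [show m = 0 by omega]),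
      mul_extMatrix_pred_moment α (fun h => by simp [show n = 0 by omega]), add_comm m n]
  rw [OpMatrix.schouten, pairing_single, pairing_single, pairing_single, key, key, key,
    show m + k + n - 2 = n + m + k - 2 by omega, show k + n + m - 2 = n + m + k - 2 by omega]
  set S : FunRing K := A (n + m + k - 2)
  push_cast
  -- Per cyclic term, with V the field component: nVfg comes from g∂(nVf), and the next product from
  -- moving ∂ off kSh in V(m g f' - n f g'). The remainders cancel in the cyclic sum.
  refine mem_exact.2 ⟨
    (n : FunRing K) * (((m : FunRing K) + n - 1) * S * dx h + dx ((k : FunRing K) * S * h)) * f * g +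
      (k : FunRing K) * S * h * ((m : FunRing K) * g * dx f - (n : FunRing K) * f * dx g) +
    ((m : FunRing K) * (((k : FunRing K) + m - 1) * S * dx f + dx ((n : FunRing K) * S * f)) * g * h +
      (n : FunRing K) * S * f * ((k : FunRing K) * h * dx g - (m : FunRing K) * g * dx h)) +
    ((k : FunRing K) * (((n : FunRing K) + k - 1) * S * dx g + dx ((m : FunRing K) * S * g)) * h * f +
      (m : FunRing K) * S * g * ((n : FunRing K) * f * dx h - (k : FunRing K) * h * dx f)), ?_⟩
  simp only [map_add, map_sub, Derivation.leibniz, smul_eq_mul, Derivation.map_natCast,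
    Derivation.map_one_eq_zero, map_zero]
  ring

/-- After integration by parts every term is a multiple of L_h = α∂(φh) - φ_x h. In the cofactor the
terms with A_{n+m-2} cancel; the variations of 1/A₀ give A₀⁻² times the Wronskian of nA_{n-1}f and
mA_{m-1}g, which cancels the Wronskian of the same functions divided by A₀, coming from the
variation of φ. -/
theorem schouten_moment_moment_phi (hα : Differential.deriv α = 0) (n m : ℕ) (f g h : FunRing K) :
    (extMatrix α).schouten (.single (.moment n) f) (.single (.moment m) g)
      (.single .phi h) ∈ exact K := by
  have hα' : dx (algebraMap K (FunRing K) α) = 0 := by rw [dx_algebraMap, hα, map_zero]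
  rw [OpMatrix.schouten, pairing_single, pairing_single, pairing_single, variation_moment_moment,
    variation_phi_moment, variation_moment_phi]
  simp only [OpMatrix.app_single, extMatrix_moment_zero_moment, extMatrix_phi_moment]
  rw [mul_extMatrix_pred_moment α (fun h => by simp [show m = 0 by omega]),
    mul_extMatrix_pred_moment α (fun h => by simp [show n = 0 by omega]),
    mul_extMatrix_pred_phi α (fun h => by simp [show m = 0 by omega]),
    mul_extMatrix_pred_phi α (fun h => by simp [show n = 0 by omega]), add_comm m n]
  set S : FunRing K := A (n + m - 2)
  set P : FunRing K := A (n - 1)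
  set Q : FunRing K := A (m - 1)
  set u : FunRing K := invA₀
  set a := algebraMap K (FunRing K) α
  have hu' : dx u = -u ^ 2 * dx (A 0) := dx_invA₀
  push_cast
  -- The first three summands are the boundary terms of the three cyclic terms; the fourth comes
  -- from αhφ∂w, with w the Wronskian of nA_{n-1}f/A₀ and mA_{m-1}g/A₀.
  refine mem_exact.2 ⟨
    (n : FunRing K) * (((n : FunRing K) + (m : FunRing K) - 1) * S * u *
      (a * dx (φ * h) - dx φ * h)) * f * g +
    a * h * φ * (((m : FunRing K) * (((m : FunRing K) - 1) * S * dx f +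
      dx ((n : FunRing K) * S * f)) * u -
      (m : FunRing K) * Q * u ^ 2 * dx ((n : FunRing K) * P * f)) * g) +
    a * ((n : FunRing K) * P * u * f) *
      (dx φ * ((m : FunRing K) * Q * u * g) + a * φ * dx ((m : FunRing K) * Q * u * g)) * h +
    a * h * φ * (dx ((n : FunRing K) * P * u * f) * ((m : FunRing K) * Q * u * g) -
      (n : FunRing K) * P * u * f * dx ((m : FunRing K) * Q * u * g)), ?_⟩
  simp only [map_add, map_sub, map_neg, Derivation.leibniz, Derivation.leibniz_pow, smul_eq_mul,
    Derivation.map_natCast, Derivation.map_one_eq_zero, map_zero, hα', hu', nsmul_eq_mul]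
  ring

/-- The field of a φ-component changes neither A₀ nor φ, so only A_{k-1} varies. One integration by
parts turns the first term into -k(k-1)A_{k-2}A₀⁻² h L_f L_g, the opposite of the third; the second
is zero. -/
theorem schouten_moment_phi_phi (hα : Differential.deriv α = 0) (k : ℕ) (f g h : FunRing K) :
    (extMatrix α).schouten (.single (.moment k) h) (.single .phi f) (.single .phi g) ∈ exact K := by
  have hα' : dx (algebraMap K (FunRing K) α) = 0 := by rw [dx_algebraMap, hα, map_zero]
  rw [OpMatrix.schouten, pairing_single, pairing_single, pairing_single, variation_phi_moment,
    variation_phi_phi, variation_moment_phi]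
  simp only [OpMatrix.app_single, extMatrix_moment_zero_phi, extMatrix_phi_phi]
  rw [mul_extMatrix_pred_phi α (fun h => by simp [h]),
    mul_extMatrix_pred_phi α (fun h => by simp [h])]
  refine mem_exact.2 ⟨algebraMap K (FunRing K) α * φ * f *
    ((k : FunRing K) * (((k : FunRing K) - 1) * A (k - 2) * invA₀ *
      (algebraMap K (FunRing K) α * dx (φ * g) - dx φ * g)) *
      invA₀ * h), ?_⟩
  simp only [map_add, map_sub, Derivation.leibniz, smul_eq_mul, Derivation.map_natCast,
    Derivation.map_one_eq_zero, map_zero, hα']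
  ring

theorem schouten_phi_phi_phi (f g h : FunRing K) :
    (extMatrix α).schouten (.single .phi f) (.single .phi g) (.single .phi h) = 0 := by
  simp [OpMatrix.schouten, pairing_single, variation_phi_phi]

theorem extMatrix_schouten_mem_exact (hα : Differential.deriv α = 0) (X Y W : Var →₀ FunRing K) :
    (extMatrix α).schouten X Y W ∈ exact K := by
  refine OpMatrix.schouten_mem_exact_of_single (fun q r s f g h => ?_) X Y W
  obtain n | _ := q <;> obtain m | _ := r <;> obtain k | _ := s
  · exact schouten_moment_moment_moment α n m k f g h
  · exact schouten_moment_moment_phi α hα n m f g h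
  · rw [← OpMatrix.schouten_rotate, ← OpMatrix.schouten_rotate]
    exact schouten_moment_moment_phi α hα k n h f g
  · exact schouten_moment_phi_phi α hα n g h f
  · rw [← OpMatrix.schouten_rotate]
    exact schouten_moment_moment_phi α hα m k g h f
  · rw [← OpMatrix.schouten_rotate]
    exact schouten_moment_phi_phi α hα m h f g
  · rw [← OpMatrix.schouten_rotate, ← OpMatrix.schouten_rotate]
    exact schouten_moment_phi_phi α hα k f g h
  · rw [schouten_phi_phi_phi]
    exact zero_mem _

end Schouten

end Benney

end BenneyExtension

end

theorem proposition13p14 {K : Type*} [CommRing K] [Differential K] (α : K)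
    (hα : Differential.deriv α = 0) :
    (BenneyExtension.extMatrix α).IsHamiltonian :=
  (BenneyExtension.extMatrix_isSkew α hα).isHamiltonian
    (BenneyExtension.extMatrix_schouten_mem_exact α hα)
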